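/- All graphs are finite and simple. For a graph $G$ on $n$ vertices with vertex degrees $d_1,\dots,d_n$, the normalized Laplacian matrix $\mathcal L(G)$ is the $n\times n$ matrix whose $(i,j)$ entry is $1$ if $i=j$ and $d_i\neq 0$, is $-1/\sqrt{d_id_j}$ if $i\ne j$ and the $i$-th and $j$-th vertices are adjacent, and is $0$ otherwise. Its eigenvalues, with multiplicity (the normalized Laplacian spectrum of $G$), are written $\delta_1(G)\le\delta_2(G)\le\dots\le\delta_n(G)$. For vertex-disjoint graphs $G_1$, with vertices $u_1,\dots,u_{n_1}$, and $G_2$, the NNS (non-neighbours splitting) join $G_1\underset{=}{\vee}G_2$ is obtained from the disjoint union of $G_1$ and $G_2$ by joining every vertex of $G_1$ to every vertex of $G_2$, adding new vertices $u_1',\dots,u_{n_1}'$, and joining $u_i'$ to $u_j$ if and only if $i\neq j$ and $u_i$, $u_j$ are not adjacent in $G_1$. **Theorem.** Let $G_1$ be an $r_1$-regular graph with $n_1\ge 1$ vertices and $G_2$ an $r_2$-regular graph with $n_2\ge1$ vertices. Let $S=\{\,i\in\{2,\dots,n_1\} : \delta_i(G_1)=1+\tfrac1{r_1}\,\}$ (with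 $S=\varnothing$ if $r_1=0$), and let $n(S)$ be the number of elements of $S$. Exponents in square brackets denote multiplicities. Put $$\theta_i^{\mp}=1+\frac{2(1+r_1-r_1\delta_i(G_1))^2}{r_1(1-\delta_i(G_1))(n_1-r_1-1)\mp\sqrt{(n_1-r_1-1)\left[r_1^2(1-\delta_i(G_1))^2(n_1-r_1-1)+4(1+r_1-r_1\delta_i(G_1))^2(n_1+n_2-1)\right]}}$$ and let $(\ast)$ be the equation $$(n_1^2+n_1n_2-n_1+r_2n_1+r_2n_2-r_2)x^3-(3n_1^2+3n_1n_2-3n_1-r_1n_1+2r_2n_1+2r_2n_2-2r_2-r_1r_2)x^2+(2n_1^2+2n_1n_2-2n_1-r_1n_1+r_2n_2)x=0.$$ (a) If $n_1\ge2$ and $S=\varnothing$, then the normalized Laplacian spectrum of $G_1\underset{=}{\vee}G_2$ consists, with multiplicity, of - $1+\frac{r_2(\delta_i(G_2)-1)}{n_1+r_2}$ for each $i=2,\dots,n_2$; - both values $\theta_i^{-}$ and $\theta_i^{+}$ for each $i=2,\dots,n_1$; - the three roots of $(\ast)$. (b) If $S=\{2,\dots,n_1\}$, then the normalized Laplacian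 spectrum of $G_1\underset{=}{\vee}G_2$ consists, with multiplicity, of - $1+\frac{r_2(\delta_i(G_2)-1)}{n_1+r_2}$ for each $i=2,\dots,n_2$; - $\left(1+\frac1{n_1+n_2-1}\right)^{[n_1-1]}$, $0^{[n_1+1]}$ and $\frac{n_1^2+2n_1n_2+r_2n_2-n_1}{(r_2+n_1)(n_1+n_2-1)}$. (c) If $S\neq\varnothing$ and $S\ne\{2,\dots,n_1\}$, then the normalized Laplacian spectrum of $G_1\underset{=}{\vee}G_2$ consists, with multiplicity, of - $1+\frac{r_2(\delta_i(G_2)-1)}{n_1+r_2}$ for each $i=2,\dots,n_2$; - both values $\theta_i^{-}$ and $\theta_i^{+}$ for each $i\in\{2,\dots,n_1\}\setminus S$; - $1^{[n(S)]}$ and $\left(1+\frac1{n_1+n_2-1}\right)^{[n(S)]}$; - the three roots of $(\ast)$. -/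

import Mathlib

open Polynomial

namespace SimpleGraph

section Spectrum

variable {V : Type*} [Fintype V] [DecidableEq V]

/-- The normalized Laplacian matrix of a graph, by its entries. The diagonal entry
at an isolated vertex is `0`. -/
noncomputable def normLapMatrix (G : SimpleGraph V) [DecidableRel G.Adj] : Matrix V V ℝ :=
  Matrix.of fun i j =>
    if i = j then (if G.degree i = 0 then 0 else 1)
    else if G.Adj i j then -(1 / √((G.degree i : ℝ) * (G.degree j : ℝ)))
    else 0

/-- The normalized Laplacian spectrum: the roots of the characteristic polynomial of the
normalized Laplacian matrix, with multiplicity. -/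
noncomputable def normLapSpectrum (G : SimpleGraph V) [DecidableRel G.Adj] : Multiset ℝ :=
  G.normLapMatrix.charpoly.roots

/-- The normalized Laplacian matrix is symmetric, so all the roots of its characteristic
polynomial are real: the spectrum has as many members as the graph has vertices. -/
theorem card_normLapSpectrum (G : SimpleGraph V) [DecidableRel G.Adj] :
    G.normLapSpectrum.card = Fintype.card V := by
  have h : G.normLapMatrix.IsHermitian := by
    ext i j
    by_cases hij : i = j
    · subst hij
      simp [normLapMatrix]
    · simp [normLapMatrix, hij, Ne.symm hij, G.adj_comm i j,
        mul_comm (√(G.degree i : ℝ))⁻¹]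
  rw [normLapSpectrum, h.roots_charpoly_eq_eigenvalues]
  simp

/-- `G.normLapEigenvalue i` is the `i`-th smallest normalized Laplacian eigenvalue `δ_i(G)`, for
`i = 1, …, n`, so that `δ_1(G) ≤ δ_2(G) ≤ … ≤ δ_n(G)` (the default value `0` is used only for `i`
greater than the number `n` of vertices; `i = 0` is not used). -/
noncomputable def normLapEigenvalue (G : SimpleGraph V) [DecidableRel G.Adj] (i : ℕ) : ℝ :=
  (G.normLapSpectrum.sort (· ≤ ·)).getD (i - 1) 0

end Spectrum

section NNSJoin

variable {V W : Type*}

/-- Adjacency in the NNS join. The vertex set is `V ⊕ (V ⊕ W)`: `inl u` is the vertex `u` of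
`G₁`, `inr (inl u)` is the added vertex `u'`, and `inr (inr w)` is the vertex `w` of `G₂`.
The added vertex `u'` is joined to those vertices `v ≠ u` of `G₁` that are not adjacent
to `u` in `G₁`, that is, to the neighbours of `u` in the complement of `G₁`. -/
def nnsAdj (G₁ : SimpleGraph V) (G₂ : SimpleGraph W) : V ⊕ (V ⊕ W) → V ⊕ (V ⊕ W) → Prop
  | .inl u, .inl v => G₁.Adj u v
  | .inl u, .inr (.inl v) => u ≠ v ∧ ¬ G₁.Adj u v
  | .inl _, .inr (.inr _) => True
  | .inr (.inl u), .inl v => u ≠ v ∧ ¬ G₁.Adj u v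
  | .inr (.inl _), .inr _ => False
  | .inr (.inr _), .inl _ => True
  | .inr (.inr _), .inr (.inl _) => False
  | .inr (.inr w), .inr (.inr z) => G₂.Adj w z

/-- The NNS (non neighbours splitting) join of two graphs. -/
def nnsJoin (G₁ : SimpleGraph V) (G₂ : SimpleGraph W) : SimpleGraph (V ⊕ (V ⊕ W)) where
  Adj := nnsAdj G₁ G₂
  symm := ⟨by
    rintro (u | u | w) (v | v | z) h <;>
      simp_all [nnsAdj, G₁.adj_comm, G₂.adj_comm, eq_comm]⟩
  loopless := ⟨by rintro (u | u | w) h <;> simp_all [nnsAdj]⟩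

instance nnsJoinDecidableAdj (G₁ : SimpleGraph V) (G₂ : SimpleGraph W) [DecidableEq V]
    [DecidableRel G₁.Adj] [DecidableRel G₂.Adj] : DecidableRel (nnsJoin G₁ G₂).Adj := by
  rintro (u | u | w) (v | v | z) <;> simp only [nnsJoin, nnsAdj] <;> infer_instance

end NNSJoin

/-- The eigenvalue contributed by an eigenvalue `δ` of `G₁`, with the sign `ε = ± 1` in front of
the square root. -/
noncomputable def nnsPairValue (n₁ n₂ r₁ δ ε : ℝ) : ℝ :=
  1 + 2 * (1 + r₁ - r₁ * δ) ^ 2 /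
    (r₁ * (1 - δ) * (n₁ - r₁ - 1) +
      ε * √((n₁ - r₁ - 1) * (r₁ ^ 2 * (1 - δ) ^ 2 * (n₁ - r₁ - 1) +
        4 * (1 + r₁ - r₁ * δ) ^ 2 * (n₁ + n₂ - 1))))

/-- The cubic polynomial that has three of the eigenvalues as its roots. -/
noncomputable def nnsCubic (n₁ n₂ r₁ r₂ : ℝ) : ℝ[X] :=
  C (n₁ ^ 2 + n₁ * n₂ - n₁ + r₂ * n₁ + r₂ * n₂ - r₂) * X ^ 3
    - C (3 * n₁ ^ 2 + 3 * n₁ * n₂ - 3 * n₁ - r₁ * n₁ + 2 * r₂ * n₁ + 2 * r₂ * n₂ - 2 * r₂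
        - r₁ * r₂) * X ^ 2
    + C (2 * n₁ ^ 2 + 2 * n₁ * n₂ - 2 * n₁ - r₁ * n₁ + r₂ * n₂) * X

end SimpleGraph

/-! Write `d`, `c`, `e` for the degrees in the join of a vertex of `G₁`, an added vertex and a
vertex of `G₂`. In `x - L` the added vertices and `G₂` form a block-diagonal corner, and eliminating
it leaves a Schur complement on `G₁`. By regularity this is a polynomial in the adjacency matrix `A`
of `G₁` plus a multiple of the all-ones matrix `J`, which affects only the all-ones vector.

An eigenvalue `l = r₁ - r₁ δ` of `A` with index at least `2` then contributes the quadratic `(x -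
1)(x - 1 + l/d) - (1 + l)²/(dc)`, with roots `θ∓`; the all-ones vectors contribute the cubic; `G₂`
contributes its remaining eigenvalues, rescaled.

Membership in `S` means `1 + l = 0`. The added vertices then decouple on that eigenvector, the
quadratic splits as `(x - 1)(x - 1 - 1/d)`, and the formula for `θ∓` degenerates to `0/0` for one
sign.

If `c = 0`, then `G₁` is complete and the added vertices are isolated, so their diagonal entry is
`x` instead of `x - 1`. A trace computation shows that this is exactly the case `S = {2, …, n₁}`. -/

open Polynomial

/-! ### Determinants of block matrices, rank-one updates and matrix polynomials -/

namespace Matrix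

variable {m n : Type*} [Fintype m] [DecidableEq m] [Fintype n] [DecidableEq n]

/-- If `D * X = C`, then the block matrix with rows `(A, B)` and `(C, D)` has determinant
`det (A - B * X) * det D`, whether or not `D` is invertible. -/
theorem det_fromBlocks_of_mul_eq {R : Type*} [CommRing R] (A : Matrix m m R) (B : Matrix m n R)
    (C : Matrix n m R) (D : Matrix n n R) (X : Matrix n m R) (h : D * X = C) :
    (fromBlocks A B C D).det = (A - B * X).det * D.det := by
  have : fromBlocks A B C D = fromBlocks (A - B * X) B 0 D * fromBlocks 1 0 X 1 := by
    rw [fromBlocks_multiply]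
    simp [h]
  rw [this, det_mul, det_fromBlocks_zero₂₁, det_fromBlocks_zero₁₂]
  simp

/-- The all-ones matrix. -/
def allOnes (m n : Type*) : Matrix m n ℝ := Matrix.of fun _ _ => 1

theorem allOnes_mul_allOnes (l m n : Type*) [Fintype n] :
    allOnes l n * allOnes n m = (Fintype.card n : ℝ) • allOnes l m := by
  ext i j
  simp [allOnes, mul_apply]

theorem det_one_add_smul_allOnes (t : ℝ) :
    (1 + t • allOnes n n).det = 1 + t * Fintype.card n := by
  have : t • allOnes n n = vecMulVec (fun _ => t) (fun _ => 1) := by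
    ext i j
    simp [allOnes, vecMulVec_apply]
  rw [this, vecMulVec_eq Unit, det_one_add_replicateCol_mul_replicateRow]
  simp [dotProduct, mul_comm]

/-- Since `M` acts on `J` as the scalar `k`, it factors out: `M + tJ = M (1 + (t/k) J)`.
Invertibility of `M` is not needed. -/
theorem det_add_smul_allOnes (M : Matrix n n ℝ) (k t : ℝ) (hk : k ≠ 0)
    (h : M * allOnes n n = k • allOnes n n) :
    (M + t • allOnes n n).det = M.det * (1 + t / k * Fintype.card n) := by
  have : M + t • allOnes n n = M * (1 + (t / k) • allOnes n n) := by
    rw [mul_add, mul_one, Matrix.mul_smul, h, smul_smul, div_mul_cancel₀ _ hk]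
  rw [this, det_mul, det_one_add_smul_allOnes]

theorem IsHermitian.det_aeval {A : Matrix n n ℝ} (hA : A.IsHermitian) (q : ℝ[X]) :
    (aeval A q).det = (A.charpoly.roots.map fun x => q.eval x).prod := by
  have key : aeval A q = Unitary.conjStarAlgAut ℝ _ hA.eigenvectorUnitary
      (diagonal fun i => q.eval (hA.eigenvalues i)) := by
    conv_lhs => rw [hA.spectral_theorem]
    rw [aeval_algHom_apply]
    congr 1
    have : diagonal (RCLike.ofReal ∘ hA.eigenvalues) =
      diagonalAlgHom ℝ (hA.eigenvalues) := by rfl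
    rw [this, aeval_algHom_apply]
    ext i j
    simp [diagonal]
  rw [key, hA.roots_charpoly_eq_eigenvalues, Unitary.conjStarAlgAut_apply, mul_assoc, det_mul_comm,
    mul_assoc, Unitary.coe_star_mul_self, mul_one, det_diagonal]
  simp

end Matrix

/-! ### Spectrum of a regular graph -/

namespace SimpleGraph

variable {V : Type*} [Fintype V] {G : SimpleGraph V} [DecidableRel G.Adj] {r : ℕ}

theorem IsRegularOfDegree.adjMatrix_mul_allOnes (h : G.IsRegularOfDegree r) (W : Type*) :
    G.adjMatrix ℝ * Matrix.allOnes V W = (r : ℝ) • Matrix.allOnes V W := by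
  ext i j
  simp [Matrix.mul_apply, Matrix.allOnes, ← neighborFinset_eq_filter, h.degree_eq]

theorem IsRegularOfDegree.allOnes_mul_adjMatrix (h : G.IsRegularOfDegree r) (W : Type*) :
    Matrix.allOnes W V * G.adjMatrix ℝ = (r : ℝ) • Matrix.allOnes W V := by
  ext i j
  simp [Matrix.mul_apply, Matrix.allOnes, G.adj_comm _ j, ← neighborFinset_eq_filter, h.degree_eq]

variable [DecidableEq V]

theorem IsRegularOfDegree.normLapMatrix_eq (h : G.IsRegularOfDegree r) :
    G.normLapMatrix = (r : ℝ)⁻¹ • G.lapMatrix ℝ := by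
  ext i j
  by_cases hij : i = j
  · subst hij
    simp only [normLapMatrix, lapMatrix, h.degree_eq]
    by_cases hr : r = 0 <;> simp [hr, degMatrix, h.degree_eq]
  · by_cases ha : G.Adj i j <;>
    simp [normLapMatrix, lapMatrix, degMatrix, h.degree_eq, hij, ha]

/-- Turns polynomials in the adjacency matrix into polynomials in the normalized Laplacian. It
survives `r = 0`, where both sides vanish. -/
theorem IsRegularOfDegree.adjMatrix_eq (h : G.IsRegularOfDegree r) :
    G.adjMatrix ℝ = (r : ℝ) • 1 - (r : ℝ) • G.normLapMatrix := by
  have hd : G.degMatrix ℝ = (r : ℝ) • 1 := by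
    ext i j
    by_cases hij : i = j <;> simp [degMatrix, h.degree_eq, hij]
  rw [h.normLapMatrix_eq, smul_smul]
  by_cases hr : r = 0
  · subst hr
    ext i j
    have : ¬ G.Adj i j := fun hij => by
      have := (G.degree_pos_iff_exists_adj i).2 ⟨j, hij⟩
      rw [h.degree_eq] at this
      exact this.false
    simp [this]
  · rw [mul_inv_cancel₀ (by exact_mod_cast hr), one_smul, lapMatrix, hd]
    simp

theorem IsRegularOfDegree.posSemidef_normLapMatrix (h : G.IsRegularOfDegree r) :
    G.normLapMatrix.PosSemidef := by
  rw [h.normLapMatrix_eq]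
  exact (posSemidef_lapMatrix ℝ G).smul (by positivity)

theorem IsRegularOfDegree.zero_mem_normLapSpectrum [Nonempty V] (h : G.IsRegularOfDegree r) :
    0 ∈ G.normLapSpectrum := by
  rw [normLapSpectrum, mem_roots G.normLapMatrix.charpoly_monic.ne_zero, IsRoot.def,
    Matrix.eval_charpoly, h.normLapMatrix_eq]
  simp [← smul_neg, Matrix.det_neg]

theorem IsRegularOfDegree.nonneg_of_mem_normLapSpectrum (h : G.IsRegularOfDegree r) {x : ℝ}
    (hx : x ∈ G.normLapSpectrum) : 0 ≤ x := by
  rw [normLapSpectrum, h.posSemidef_normLapMatrix.1.roots_charpoly_eq_eigenvalues] at hx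
  obtain ⟨i, -, rfl⟩ := Multiset.mem_map.1 hx
  exact h.posSemidef_normLapMatrix.eigenvalues_nonneg i

/-- Positive semidefiniteness makes the eigenvalue `0` of the all-ones vector the head of the sorted
list. This singles out `δ₁`, where the `J` terms act. -/
theorem IsRegularOfDegree.normLapSpectrum_eq_cons [Nonempty V] (h : G.IsRegularOfDegree r) :
    G.normLapSpectrum =
      0 ::ₘ (Finset.Icc 2 (Fintype.card V)).val.map fun i => G.normLapEigenvalue i := by
  have hcard := G.card_normLapSpectrum
  have hs := Multiset.sort_eq G.normLapSpectrum (· ≤ ·)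
  have hp := Multiset.pairwise_sort G.normLapSpectrum (· ≤ ·)
  have h0 := h.zero_mem_normLapSpectrum
  have hn := fun x => h.nonneg_of_mem_normLapSpectrum (x := x)
  unfold normLapEigenvalue
  rw [← hcard]
  generalize G.normLapSpectrum.sort (· ≤ ·) = l at *
  rw [← hs] at h0 hn ⊢
  cases l with
  | nil => simp at h0
  | cons a t =>
    have ha : a = 0 := by
      refine le_antisymm ?_ (hn a (by simp))
      rcases List.mem_cons.1 (Multiset.mem_coe.1 h0) with h1 | h1
      · exact h1.ge
      · exact (List.pairwise_cons.1 hp).1 _ h1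
    subst ha
    rw [← Multiset.cons_coe]
    congr 1
    -- Eigenvalues are numbered from `1` and the head is removed, so position `j` of the tail is
    -- index `j + 2`.
    have hI : Finset.Icc 2 (Multiset.card (0 ::ₘ (t : Multiset ℝ))) =
        (Finset.range t.length).map (addRightEmbedding 2) := by
      ext i
      simp only [Multiset.card_cons, Multiset.coe_card, Finset.mem_Icc, Finset.mem_map,
        Finset.mem_range, addRightEmbedding_apply]
      exact ⟨fun hi => ⟨i - 2, by omega, by omega⟩, by rintro ⟨j, hj, rfl⟩; omega⟩
    rw [hI]
    simp only [Finset.map_val, Multiset.map_map, Finset.range_val, Multiset.range]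
    rw [Multiset.map_coe]
    congr 1
    refine List.ext_getElem (by simp) fun i h1 h2 => ?_
    simp [List.getD, h1]

theorem IsRegularOfDegree.det_aeval_normLapMatrix [Nonempty V] (h : G.IsRegularOfDegree r)
    (q : ℝ[X]) : (aeval G.normLapMatrix q).det =
      q.eval 0 * ∏ i ∈ Finset.Icc 2 (Fintype.card V), q.eval (G.normLapEigenvalue i) := by
  have := h.posSemidef_normLapMatrix.1.det_aeval q
  rw [this, ← normLapSpectrum, h.normLapSpectrum_eq_cons]
  simp

end SimpleGraph

/-! ### Matrix of the join and its Schur complement -/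

namespace SimpleGraph

open Matrix

variable {V W : Type*} [DecidableEq V]
  {G₁ : SimpleGraph V} [DecidableRel G₁.Adj] {G₂ : SimpleGraph W} [DecidableRel G₂.Adj] {r₁ r₂ : ℕ}

/-- The adjacency matrix of the complement, written without decidability side conditions. -/
noncomputable def nonAdjMatrix (G : SimpleGraph V) [DecidableRel G.Adj] : Matrix V V ℝ :=
  allOnes V V - 1 - G.adjMatrix ℝ

theorem nonAdjMatrix_apply (u v : V) :
    G₁.nonAdjMatrix u v = if u ≠ v ∧ ¬ G₁.Adj u v then 1 else 0 := by
  by_cases huv : u = v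
  · subst huv
    simp [nonAdjMatrix, allOnes]
  · by_cases ha : G₁.Adj u v <;> simp [nonAdjMatrix, allOnes, huv, ha]

variable [Fintype V] [Fintype W]

/-- Expand `(J - (1 + A))²`: by regularity every term containing `J` is a multiple of `J`. -/
theorem IsRegularOfDegree.nonAdjMatrix_mul_self (h : G₁.IsRegularOfDegree r₁) :
    G₁.nonAdjMatrix * G₁.nonAdjMatrix = (1 + G₁.adjMatrix ℝ) * (1 + G₁.adjMatrix ℝ) +
      ((Fintype.card V : ℝ) - 2 * (1 + r₁)) • allOnes V V := by
  have h1 := h.adjMatrix_mul_allOnes V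
  have h2 := h.allOnes_mul_adjMatrix V
  have h3 := allOnes_mul_allOnes V V V
  simp only [nonAdjMatrix, sub_mul, mul_sub, h1, h2, h3, mul_add, add_mul, one_mul, mul_one]
  module

theorem IsRegularOfDegree.sum_nonAdj (h : G₁.IsRegularOfDegree r₁) (u : V) :
    (∑ v, if u ≠ v ∧ ¬ G₁.Adj u v then (1 : ℝ) else 0) = Fintype.card V - 1 - r₁ := by
  simp only [← nonAdjMatrix_apply]
  simp [nonAdjMatrix, allOnes, Finset.sum_sub_distrib, Matrix.one_apply,
    ← neighborFinset_eq_filter, h.degree_eq]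

theorem degree_nnsJoin_inl (h₁ : G₁.IsRegularOfDegree r₁) (u : V) :
    ((nnsJoin G₁ G₂).degree (.inl u) : ℝ) = Fintype.card V + Fintype.card W - 1 := by
  rw [degree_eq_sum_if_adj]
  simp only [Fintype.sum_sum_type, nnsJoin, nnsAdj, h₁.sum_nonAdj]
  rw [← degree_eq_sum_if_adj, h₁.degree_eq]
  simp
  ring

theorem degree_nnsJoin_inr_inl (h₁ : G₁.IsRegularOfDegree r₁) (u : V) :
    ((nnsJoin G₁ G₂).degree (.inr (.inl u)) : ℝ) = Fintype.card V - 1 - r₁ := by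
  rw [degree_eq_sum_if_adj]
  simp only [Fintype.sum_sum_type, nnsJoin, nnsAdj, h₁.sum_nonAdj]
  simp

theorem degree_nnsJoin_inr_inr (h₂ : G₂.IsRegularOfDegree r₂) (w : W) :
    ((nnsJoin G₁ G₂).degree (.inr (.inr w)) : ℝ) = Fintype.card V + r₂ := by
  rw [degree_eq_sum_if_adj]
  simp only [Fintype.sum_sum_type, nnsJoin, nnsAdj]
  rw [← degree_eq_sum_if_adj, h₂.degree_eq]
  simp

theorem normLapMatrix_apply_of_degree {V : Type*} [Fintype V] [DecidableEq V] (G : SimpleGraph V)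
    [DecidableRel G.Adj] (i j : V) {a b : ℝ} (ha : (G.degree i : ℝ) = a)
    (hb : (G.degree j : ℝ) = b) : G.normLapMatrix i j =
      if i = j then (if a = 0 then 0 else 1) else if G.Adj i j then -(1 / √(a * b)) else 0 := by
  subst ha hb
  simp [normLapMatrix]

variable [DecidableEq W]

theorem scalar_sub_normLapMatrix_nnsJoin [Nonempty V] [Nonempty W]
    (h₁ : G₁.IsRegularOfDegree r₁) (h₂ : G₂.IsRegularOfDegree r₂) {d c e : ℝ}
    (hd : d = Fintype.card V + Fintype.card W - 1) (hc : c = Fintype.card V - 1 - r₁)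
    (he : e = Fintype.card V + r₂) (x : ℝ) :
    scalar _ x - (nnsJoin G₁ G₂).normLapMatrix =
      fromBlocks ((x - 1) • 1 + d⁻¹ • G₁.adjMatrix ℝ)
        (fromCols ((√(d * c))⁻¹ • G₁.nonAdjMatrix) ((√(d * e))⁻¹ • allOnes V W))
        (fromRows ((√(d * c))⁻¹ • G₁.nonAdjMatrix) ((√(d * e))⁻¹ • allOnes W V))
        (fromBlocks ((if c = 0 then x else x - 1) • 1) 0 0
          ((x - 1) • 1 + e⁻¹ • G₂.adjMatrix ℝ)) := by
  have hV : (1 : ℝ) ≤ Fintype.card V := by exact_mod_cast Fintype.card_pos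
  have hW : (1 : ℝ) ≤ Fintype.card W := by exact_mod_cast Fintype.card_pos
  have hd0 : 0 < d := by rw [hd]; linarith
  have he0 : 0 < e := by rw [he]; positivity
  have d1 := fun u => hd ▸ degree_nnsJoin_inl (G₂ := G₂) h₁ u
  have d2 := fun u => hc ▸ degree_nnsJoin_inr_inl (G₂ := G₂) h₁ u
  have d3 := fun w => he ▸ degree_nnsJoin_inr_inr (G₁ := G₁) h₂ w
  ext i j
  rw [Matrix.sub_apply]
  rcases i with u | u | w <;> rcases j with v | v | z
  · rw [normLapMatrix_apply_of_degree _ _ _ (d1 u) (d1 v)]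
    by_cases huv : u = v
    · subst huv; simp [hd0.ne']
    · by_cases ha : G₁.Adj u v <;> simp [huv, nnsJoin, nnsAdj, ha, hd0.le]
  · rw [normLapMatrix_apply_of_degree _ _ _ (d1 u) (d2 v)]
    simp only [nnsJoin, nnsAdj]
    simp [nonAdjMatrix_apply]
    split_ifs <;> simp
  · rw [normLapMatrix_apply_of_degree _ _ _ (d1 u) (d3 z)]
    simp [nnsJoin, nnsAdj, allOnes]
  · rw [normLapMatrix_apply_of_degree _ _ _ (d2 u) (d1 v)]
    simp only [nnsJoin, nnsAdj]
    simp [nonAdjMatrix_apply, mul_comm]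
    split_ifs <;> simp
  · rw [normLapMatrix_apply_of_degree _ _ _ (d2 u) (d2 v)]
    by_cases huv : u = v
    · subst huv; simp; split_ifs <;> simp
    · simp [huv, nnsJoin, nnsAdj]; split_ifs <;> simp [huv]
  · rw [normLapMatrix_apply_of_degree _ _ _ (d2 u) (d3 z)]
    simp [nnsJoin, nnsAdj]
  · rw [normLapMatrix_apply_of_degree _ _ _ (d3 w) (d1 v)]
    simp [nnsJoin, nnsAdj, allOnes, mul_comm]
  · rw [normLapMatrix_apply_of_degree _ _ _ (d3 w) (d2 v)]
    simp [nnsJoin, nnsAdj]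
  · rw [normLapMatrix_apply_of_degree _ _ _ (d3 w) (d3 z)]
    by_cases huv : w = z
    · subst huv; simp [he0.ne']
    · by_cases ha : G₂.Adj w z <;> simp [huv, nnsJoin, nnsAdj, ha, he0.le]

/-- The Schur complement computed at one point `x` where the scalars divided by are nonzero. When `c
= 0`, the convention `0⁻¹ = 0` removes the coupling terms, so one formula serves both cases. -/
theorem eval_charpoly_nnsJoin [Nonempty V] [Nonempty W]
    (h₁ : G₁.IsRegularOfDegree r₁) (h₂ : G₂.IsRegularOfDegree r₂) {n₁ n₂ : ℕ}
    (hn₁ : Fintype.card V = n₁) (hn₂ : Fintype.card W = n₂) {d c e : ℝ}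
    (hd : d = n₁ + n₂ - 1) (hc : c = n₁ - 1 - r₁) (he : e = n₁ + r₂) {x y z k k₂ : ℝ}
    (hy : y = x - 1) (hz : z = if c = 0 then x else x - 1)
    (hk : k = y + r₁ / d - (d * c)⁻¹ / z * (1 + r₁) ^ 2) (hk₂ : k₂ = y + r₂ / e)
    (hz0 : z ≠ 0) (hk0 : k ≠ 0) (hk₂0 : k₂ ≠ 0) :
    (nnsJoin G₁ G₂).normLapMatrix.charpoly.eval x =
      z ^ n₁ * (∏ j ∈ Finset.Icc 2 n₂, (y + (r₂ - r₂ * G₂.normLapEigenvalue j) / e)) * k₂ *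
      (∏ i ∈ Finset.Icc 2 n₁, (y + (r₁ - r₁ * G₁.normLapEigenvalue i) / d -
        (d * c)⁻¹ / z * (1 + (r₁ - r₁ * G₁.normLapEigenvalue i)) ^ 2)) *
      (y + r₁ / d - (d * c)⁻¹ / z * c ^ 2 - n₁ * n₂ / (d * e * k₂)) := by
  have hV : (1 : ℝ) ≤ n₁ := by rw [← hn₁]; exact_mod_cast Fintype.card_pos
  have hW : (1 : ℝ) ≤ n₂ := by rw [← hn₂]; exact_mod_cast Fintype.card_pos
  have hd0 : 0 < d := by rw [hd]; linarith
  have he0 : 0 < e := by rw [he]; positivity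
  have hc0 : 0 ≤ c := by
    have := degree_nnsJoin_inr_inl (G₂ := G₂) h₁ (Classical.arbitrary V)
    rw [hn₁, ← hc] at this
    rw [← this]; positivity
  rw [eval_charpoly, scalar_sub_normLapMatrix_nnsJoin h₁ h₂ (hn₁ ▸ hn₂ ▸ hd) (hn₁ ▸ hc)
    (hn₁ ▸ he), ← hz, ← hy]
  set a := (√(d * c))⁻¹ with ha
  set b := (√(d * e))⁻¹ with hb
  have ha2 : a * a = (d * c)⁻¹ := by
    rw [ha, ← mul_inv, Real.mul_self_sqrt (by positivity)]
  have hb2 : b * b = (d * e)⁻¹ := by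
    rw [hb, ← mul_inv, Real.mul_self_sqrt (by positivity)]
  set K := y • (1 : Matrix W W ℝ) + e⁻¹ • G₂.adjMatrix ℝ with hK
  have hKJ : K * allOnes W V = k₂ • allOnes W V := by
    rw [hK, Matrix.add_mul, smul_mul, smul_mul, Matrix.one_mul, h₂.adjMatrix_mul_allOnes, hk₂, smul_smul,
      ← add_smul]
    congr 1; ring
  -- The corner block acts as `z` on the added vertices and as `k₂` on the all-ones columns over
  -- `G₂`, so dividing by these scalars solves `D * X = C` without inverting `K`.
  rw [det_fromBlocks_of_mul_eq _ _ _ _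
    (fromRows ((a / z) • G₁.nonAdjMatrix) ((b / k₂) • allOnes W V))]
  swap
  · rw [fromBlocks_mul_fromRows]
    simp only [Matrix.zero_mul, smul_zero, add_zero, zero_add, smul_mul, Matrix.one_mul,
      Matrix.mul_smul, hKJ, smul_smul]
    rw [div_mul_cancel₀ _ hz0, div_mul_cancel₀ _ hk₂0]
  have hdetK : K.det = k₂ *
      ∏ j ∈ Finset.Icc 2 n₂, (y + (r₂ - r₂ * G₂.normLapEigenvalue j) / e) := by
    have : K = aeval G₂.normLapMatrix (C y + C (r₂ / e) * (1 - X)) := by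
      rw [hK, h₂.adjMatrix_eq]
      simp [Algebra.algebraMap_eq_smul_one]
      module
    rw [this, h₂.det_aeval_normLapMatrix, hn₂, hk₂]
    simp only [eval_add, eval_mul, eval_C, eval_sub, eval_one, eval_X]
    congr 1
    · ring
    · exact Finset.prod_congr rfl fun _ _ => by ring
  set M := y • (1 : Matrix V V ℝ) + d⁻¹ • G₁.adjMatrix ℝ -
    ((d * c)⁻¹ / z) • ((1 + G₁.adjMatrix ℝ) * (1 + G₁.adjMatrix ℝ)) with hM
  have hMJ : M * allOnes V V = k • allOnes V V := by
    simp only [hM, add_mul, sub_mul, smul_mul, one_mul, h₁.adjMatrix_mul_allOnes, mul_assoc,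
      mul_add, Matrix.mul_smul, hk]
    module
  have hdetM : M.det = k * ∏ i ∈ Finset.Icc 2 n₁, (y + (r₁ - r₁ * G₁.normLapEigenvalue i) / d -
        (d * c)⁻¹ / z * (1 + (r₁ - r₁ * G₁.normLapEigenvalue i)) ^ 2) := by
    have : M = aeval G₁.normLapMatrix (C y + C (r₁ / d) * (1 - X) -
        C ((d * c)⁻¹ / z) * (1 + C (r₁ : ℝ) * (1 - X)) ^ 2) := by
      rw [hM, h₁.adjMatrix_eq]
      simp [Algebra.algebraMap_eq_smul_one, pow_two, -map_natCast]
      simp only [smul_sub]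
      module
    rw [this, h₁.det_aeval_normLapMatrix, hn₁, hk]
    simp only [eval_add, eval_mul, eval_C, eval_sub, eval_one, eval_X, eval_pow]
    congr 1
    · ring
    · exact Finset.prod_congr rfl fun _ _ => by ring
  have hS : y • (1 : Matrix V V ℝ) + d⁻¹ • G₁.adjMatrix ℝ -
      fromCols (a • G₁.nonAdjMatrix) (b • allOnes V W) *
        fromRows ((a / z) • G₁.nonAdjMatrix) ((b / k₂) • allOnes W V) =
      M + (-((d * c)⁻¹ / z * (n₁ - 2 * (1 + r₁))) - (d * e)⁻¹ / k₂ * n₂) • allOnes V V := by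
    rw [fromCols_mul_fromRows]
    simp only [smul_mul, Matrix.mul_smul, smul_smul, h₁.nonAdjMatrix_mul_self,
      allOnes_mul_allOnes, hn₁, hn₂, ← ha2, ← hb2, hM]
    module
  rw [hS, det_add_smul_allOnes M k _ hk0 hMJ, hdetM, det_fromBlocks_zero₂₁, hdetK, det_smul,
    det_one, hn₁]
  -- The eigenvalue `k` of `M` on the all-ones vector cancels; `c² = (1 + r₁)² + n₁ (n₁ - 2(1 +
  -- r₁))` absorbs the `J` part of the squared complement.
  have : k * (1 + (-((d * c)⁻¹ / z * (n₁ - 2 * (1 + r₁))) - (d * e)⁻¹ / k₂ * n₂) / k * n₁) =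
      y + r₁ / d - (d * c)⁻¹ / z * c ^ 2 - n₁ * n₂ / (d * e * k₂) := by
    rw [mul_add, mul_one, ← mul_assoc, mul_div_cancel₀ _ hk0, hk, hc]
    ring
  rw [← this]
  ring

end SimpleGraph

/-! ### Factors of the characteristic polynomial -/

namespace SimpleGraph

open Matrix

/-- Vieta: the two denominators multiply to `-4c(1 + l)²d`, which is nonzero exactly because `1 + l
≠ 0`; sum and product of the roots follow. -/
theorem X_sub_C_nnsPairValue_mul {n₁ n₂ r₁ δ c d l : ℝ} (hc : c = n₁ - 1 - r₁)
    (hd : d = n₁ + n₂ - 1) (hl : l = r₁ - r₁ * δ) (hc0 : 0 < c) (hd0 : 0 < d) (h : 1 + l ≠ 0) :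
    (X - C (nnsPairValue n₁ n₂ r₁ δ (-1))) * (X - C (nnsPairValue n₁ n₂ r₁ δ 1)) =
      (X - 1) * (X - C (1 - l / d)) - C ((d * c)⁻¹ * (1 + l) ^ 2) := by
  obtain ⟨s, hs⟩ : ∃ s, s = √(c * (l ^ 2 * c + 4 * (1 + l) ^ 2 * d)) := ⟨_, rfl⟩
  have hs2 : s * s = c * (l ^ 2 * c + 4 * (1 + l) ^ 2 * d) := by
    rw [hs, Real.mul_self_sqrt (by positivity)]
  have hval : ∀ ε, nnsPairValue n₁ n₂ r₁ δ ε = 1 + 2 * (1 + l) ^ 2 / (l * c + ε * s) := by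
    intro ε
    have e1 : n₁ - r₁ - 1 = c := by rw [hc]; ring
    have e2 : 1 + r₁ - r₁ * δ = 1 + l := by rw [hl]; ring
    have e3 : r₁ * (1 - δ) = l := by rw [hl]; ring
    rw [nnsPairValue, e1, e2, e3, ← hd, ← mul_pow, e3, hs]
  rw [hval, hval]
  have hpq : (l * c + -1 * s) * (l * c + 1 * s) = -(4 * c * (1 + l) ^ 2 * d) := by
    linear_combination -hs2
  have hpq0 : (l * c + -1 * s) * (l * c + 1 * s) ≠ 0 := by
    rw [hpq, neg_ne_zero]; positivity
  have hp0 := left_ne_zero_of_mul hpq0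
  have hq0 := right_ne_zero_of_mul hpq0
  have hsum : 2 * (1 + l) ^ 2 / (l * c + -1 * s) + 2 * (1 + l) ^ 2 / (l * c + 1 * s) =
      -(l / d) := by
    rw [div_add_div _ _ hp0 hq0, hpq]
    field_simp
    ring
  have hprod : 2 * (1 + l) ^ 2 / (l * c + -1 * s) * (2 * (1 + l) ^ 2 / (l * c + 1 * s)) =
      -((d * c)⁻¹ * (1 + l) ^ 2) := by
    rw [div_mul_div_comm, hpq]
    field_simp
    ring
  generalize 2 * (1 + l) ^ 2 / (l * c + -1 * s) = u at hsum hprod ⊢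
  generalize 2 * (1 + l) ^ 2 / (l * c + 1 * s) = v at hsum hprod ⊢
  have hsum' : C u + C v = -C (l / d) := by rw [← C_add, hsum, C_neg]
  have hprod' : C u * C v = -C ((d * c)⁻¹ * (1 + l) ^ 2) := by rw [← C_mul, hprod, C_neg]
  simp only [C_add, C_sub, C_1]
  linear_combination (1 - X) * hsum' + hprod'

theorem nnsCubic_eq {n₁ n₂ r₁ r₂ c d e : ℝ} (hc : c = n₁ - 1 - r₁)
    (hd : d = n₁ + n₂ - 1) (he : e = n₁ + r₂) (hd0 : d ≠ 0) (he0 : e ≠ 0) :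
    ((X - 1) * (X - C (1 - r₁ / d)) - C ((d * c)⁻¹ * c ^ 2)) * (X - C (1 - r₂ / e)) -
      C (n₁ * n₂ / (d * e)) * (X - 1) = C (d * e)⁻¹ * nnsCubic n₁ n₂ r₁ r₂ := by
  refine Polynomial.funext fun x => ?_
  simp only [nnsCubic, eval_add, eval_sub, eval_mul, eval_C, eval_X, eval_pow, eval_one]
  field_simp
  rw [hc, hd, he]
  ring

theorem nnsCubic_ne_zero {n₁ n₂ r₁ r₂ : ℝ} (hd0 : n₁ + n₂ - 1 ≠ 0) (he0 : n₁ + r₂ ≠ 0) :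
    nnsCubic n₁ n₂ r₁ r₂ ≠ 0 := by
  intro h
  have h3 := congrArg (fun p => coeff p 3) h
  simp [nnsCubic, -map_add, -map_sub, -map_mul, -map_pow] at h3
  refine mul_ne_zero hd0 he0 ?_
  linear_combination h3

theorem roots_C_mul_prod_mul {a : ℝ} (ha : a ≠ 0) (s : Multiset ℝ) {q : ℝ[X]} (hq : q ≠ 0) :
    (C a * ((s.map fun x => X - C x).prod * q)).roots = s + q.roots := by
  have hs : (s.map fun x => X - C x).prod ≠ 0 :=
    (monic_multiset_prod_of_monic _ _ fun x _ => monic_X_sub_C x).ne_zero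
  rw [roots_C_mul _ ha, roots_mul (mul_ne_zero hs hq), roots_multiset_prod_X_sub_C]

variable {V W : Type*} [Fintype V] [DecidableEq V] [Fintype W] [DecidableEq W]
  {G₁ : SimpleGraph V} [DecidableRel G₁.Adj] {G₂ : SimpleGraph W} [DecidableRel G₂.Adj] {r₁ r₂ : ℕ}

theorem charpoly_nnsJoin [Nonempty V] [Nonempty W]
    (h₁ : G₁.IsRegularOfDegree r₁) (h₂ : G₂.IsRegularOfDegree r₂) {n₁ n₂ : ℕ}
    (hn₁ : Fintype.card V = n₁) (hn₂ : Fintype.card W = n₂) {d c e : ℝ}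
    (hd : d = n₁ + n₂ - 1) (hc : c = n₁ - 1 - r₁) (he : e = n₁ + r₂) {Z : ℝ[X]}
    (hZ : Z = if c = 0 then X else X - 1) :
    (nnsJoin G₁ G₂).normLapMatrix.charpoly =
      (∏ j ∈ Finset.Icc 2 n₂, (X - C (1 + r₂ * (G₂.normLapEigenvalue j - 1) / e))) *
      (∏ i ∈ Finset.Icc 2 n₁, (Z * (X - C (1 - (r₁ - r₁ * G₁.normLapEigenvalue i) / d)) -
        C ((d * c)⁻¹ * (1 + (r₁ - r₁ * G₁.normLapEigenvalue i)) ^ 2))) *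
      ((Z * (X - C (1 - r₁ / d)) - C ((d * c)⁻¹ * c ^ 2)) * (X - C (1 - r₂ / e)) -
        C (n₁ * n₂ / (d * e)) * Z) := by
  have hV : 1 ≤ n₁ := by rw [← hn₁]; exact Fintype.card_pos
  have hV' : (1 : ℝ) ≤ n₁ := by exact_mod_cast hV
  have hW : (1 : ℝ) ≤ n₂ := by rw [← hn₂]; exact_mod_cast Fintype.card_pos
  have hd0 : 0 < d := by rw [hd]; linarith
  have he0 : 0 < e := by rw [he]; positivity
  have hc0 : 0 ≤ c := by
    have := degree_nnsJoin_inr_inl (G₂ := G₂) h₁ (Classical.arbitrary V)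
    rw [hn₁, ← hc] at this
    rw [← this]; positivity
  -- Beyond this bound `z > 1`, and both `k` and `k₂` are positive, so the pointwise formula applies
  -- at infinitely many `x`.
  refine eq_of_infinite_eval_eq _ _
    ((Set.Ioi_infinite (2 + (d * c)⁻¹ * (1 + r₁) ^ 2)).mono fun x hx => ?_)
  have hB : 0 ≤ (d * c)⁻¹ * (1 + (r₁ : ℝ)) ^ 2 := by positivity
  rw [Set.mem_Ioi] at hx
  obtain ⟨z, hz⟩ : ∃ z, z = if c = 0 then x else x - 1 := ⟨_, rfl⟩
  have hz1 : 1 < z := by rw [hz]; split_ifs <;> linarith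
  have hZz : Z.eval x = z := by rw [hZ, hz]; split_ifs <;> simp
  have hr : 0 ≤ r₁ / d := by positivity
  have hr₂ : 0 ≤ r₂ / e := by positivity
  have hle : (d * c)⁻¹ / z * (1 + r₁) ^ 2 ≤ (d * c)⁻¹ * (1 + r₁) ^ 2 := by
    gcongr
    exact div_le_self (by positivity) hz1.le
  have hk₂ : x - 1 + r₂ / e ≠ 0 := by
    apply ne_of_gt; linarith
  rw [Set.mem_ofPred_eq, eval_charpoly_nnsJoin h₁ h₂ hn₁ hn₂ hd hc he rfl hz rfl rfl
    (by linarith) (by apply ne_of_gt; linarith) hk₂]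
  have hz0 : z ≠ 0 := by linarith
  -- One factor `z` clears the denominator of each quadratic and the remaining one that of the
  -- all-ones factor.
  have hzpow : z ^ n₁ = z * ∏ i ∈ Finset.Icc 2 n₁, z := by
    rw [Finset.prod_const, ← pow_succ', Nat.card_Icc]
    congr 1
    omega
  have hlast : (z * (x - (1 - r₁ / d)) - (d * c)⁻¹ * c ^ 2) * (x - (1 - r₂ / e)) -
      n₁ * n₂ / (d * e) * z = z * (x - 1 + r₂ / e) *
        (x - 1 + r₁ / d - (d * c)⁻¹ / z * c ^ 2 - n₁ * n₂ / (d * e * (x - 1 + r₂ / e))) := by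
    generalize (d * c)⁻¹ = κ
    have : x - (1 - r₂ / e) = x - 1 + r₂ / e := by ring
    rw [this]
    generalize x - 1 + r₂ / e = k at hk₂ ⊢
    field_simp
    ring
  simp only [eval_mul, eval_sub, eval_prod, eval_X, eval_C, hZz]
  rw [hlast, hzpow]
  have e1 : ∀ i, z * (x - (1 - (r₁ - r₁ * G₁.normLapEigenvalue i) / d)) -
      (d * c)⁻¹ * (1 + (r₁ - r₁ * G₁.normLapEigenvalue i)) ^ 2 =
      z * (x - 1 + (r₁ - r₁ * G₁.normLapEigenvalue i) / d -
        (d * c)⁻¹ / z * (1 + (r₁ - r₁ * G₁.normLapEigenvalue i)) ^ 2) := by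
    intro i
    generalize (d * c)⁻¹ = κ
    field_simp
    ring
  have e2 : ∀ j, x - (1 + r₂ * (G₂.normLapEigenvalue j - 1) / e) =
      x - 1 + (r₂ - r₂ * G₂.normLapEigenvalue j) / e := fun j => by ring
  simp only [e1, e2, Finset.prod_mul_distrib]
  ring

/-- The adjacency matrix has trace `0`. The factor `r₁` keeps the identity true for edgeless graphs.
-/
theorem IsRegularOfDegree.sum_normLapEigenvalue [Nonempty V] (h : G₁.IsRegularOfDegree r₁) :
    ∑ i ∈ Finset.Icc 2 (Fintype.card V), (r₁ : ℝ) * G₁.normLapEigenvalue i =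
      r₁ * Fintype.card V := by
  have hH := h.posSemidef_normLapMatrix.1
  have h1 : (r₁ : ℝ) * G₁.normLapMatrix.trace = r₁ * Fintype.card V := by
    have := congrArg trace h.adjMatrix_eq
    simp only [trace_adjMatrix, trace_sub, trace_smul, trace_one, smul_eq_mul] at this
    linarith
  have h2 : G₁.normLapMatrix.trace = G₁.normLapSpectrum.sum := by
    rw [normLapSpectrum, hH.trace_eq_sum_eigenvalues, hH.roots_charpoly_eq_eigenvalues]
    simp
  rw [h.normLapSpectrum_eq_cons] at h2
  rw [← h1, h2, ← Finset.mul_sum]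
  simp

/-- Here the graph is complete, so `A = J - 1`, and all its eigenvalues other than that of the
all-ones vector are `-1`. -/
theorem IsRegularOfDegree.eigenvalue_of_card_eq [Nonempty V] (h : G₁.IsRegularOfDegree r₁)
    (hV : Fintype.card V = r₁ + 1) {i : ℕ} (hi : i ∈ Finset.Icc 2 (Fintype.card V)) :
    1 + ((r₁ : ℝ) - r₁ * G₁.normLapEigenvalue i) = 0 := by
  have hA : G₁.adjMatrix ℝ = allOnes V V - 1 := by
    ext u v
    by_cases huv : u = v
    · subst huv; simp [allOnes]
    · have hs : G₁.neighborFinset u = Finset.univ.erase u :=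
        Finset.eq_of_subset_of_card_le
          (fun w hw => Finset.mem_erase.2
            ⟨((G₁.mem_neighborFinset u w).1 hw).ne', Finset.mem_univ w⟩)
          (by rw [Finset.card_erase_of_mem (Finset.mem_univ u), Finset.card_univ, hV,
            card_neighborFinset_eq_degree, h.degree_eq, Nat.add_sub_cancel])
      have : G₁.Adj u v := by
        rw [← mem_neighborFinset, hs]
        simp [Ne.symm huv]
      simp [allOnes, huv, this]
  have key : ∏ i ∈ Finset.Icc 2 (Fintype.card V),
      (X + C ((r₁ : ℝ) - r₁ * G₁.normLapEigenvalue i)) = (X - 1) ^ r₁ := by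
    refine eq_of_infinite_eval_eq _ _ ((Set.Ioi_infinite 1).mono fun x hx => ?_)
    rw [Set.mem_Ioi] at hx
    have hx1 : x - 1 ≠ 0 := by linarith
    have hxr : x + r₁ ≠ 0 := by positivity
    have e1 : aeval G₁.normLapMatrix (C x + C (r₁ : ℝ) * (1 - X)) =
        (x - 1) • (1 : Matrix V V ℝ) + (1 : ℝ) • allOnes V V := by
      have : allOnes V V = 1 + G₁.adjMatrix ℝ := by rw [hA]; abel
      rw [this, h.adjMatrix_eq]
      simp [Algebra.algebraMap_eq_smul_one, -map_natCast]
      module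
    have e2 := h.det_aeval_normLapMatrix (C x + C (r₁ : ℝ) * (1 - X))
    rw [e1, det_add_smul_allOnes _ (x - 1) _ hx1 (by rw [smul_mul, one_mul]), det_smul, det_one,
      hV] at e2
    simp only [eval_add, eval_mul, eval_C, eval_sub, eval_one, eval_X] at e2
    rw [Set.mem_ofPred_eq, hV]
    simp only [eval_prod, eval_pow, eval_add, eval_sub, eval_X, eval_C, eval_one]
    apply mul_left_cancel₀ hxr
    have e3 : (x - 1) ^ (r₁ + 1) * 1 * (1 + 1 / (x - 1) * ((r₁ + 1 : ℕ) : ℝ)) =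
        (x + r₁) * (x - 1) ^ r₁ := by
      push_cast
      field_simp
      ring
    rw [← e3, e2]
    congr 1
    · ring
    · exact Finset.prod_congr rfl fun _ _ => by ring
  -- At this root of the left side, `(x - 1) ^ r₁` must vanish; the existence of an index `i ≥ 2`
  -- forces `r₁ ≠ 0`.
  have := congrArg (eval (-((r₁ : ℝ) - r₁ * G₁.normLapEigenvalue i))) key
  rw [eval_prod, Finset.prod_eq_zero hi (by simp)] at this
  simp only [eval_pow, eval_sub, eval_X, eval_one] at this
  have := (pow_eq_zero_iff (by have := Finset.mem_Icc.1 hi; omega)).1 this.symm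
  linarith

theorem one_add_sub_mul_eq_zero_iff (r : ℕ) (δ : ℝ) :
    1 + ((r : ℝ) - r * δ) = 0 ↔ 0 < r ∧ δ = 1 + 1 / (r : ℝ) := by
  rcases Nat.eq_zero_or_pos r with rfl | hr
  · simp
  · have : (r : ℝ) ≠ 0 := by positivity
    simp only [hr, true_and]
    rw [one_add_div this, eq_div_iff this]
    constructor <;> intro h <;> linarith

/-! ### Spectrum of the join for noncomplete and for complete `G₁` -/

theorem normLapSpectrum_nnsJoin_of_ne [Nonempty V] [Nonempty W]
    (h₁ : G₁.IsRegularOfDegree r₁) (h₂ : G₂.IsRegularOfDegree r₂) {n₁ n₂ : ℕ}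
    (hn₁ : Fintype.card V = n₁) (hn₂ : Fintype.card W = n₂) (hc : (n₁ : ℝ) - 1 - r₁ ≠ 0)
    {S : Finset ℕ}
    (hS : S = {i ∈ Finset.Icc 2 n₁ | 0 < r₁ ∧ G₁.normLapEigenvalue i = 1 + 1 / (r₁ : ℝ)}) :
    (nnsJoin G₁ G₂).normLapSpectrum =
      (Finset.Icc 2 n₂).val.map
          (fun i => 1 + (r₂ : ℝ) * (G₂.normLapEigenvalue i - 1) / ((n₁ : ℝ) + r₂))
        + (Finset.Icc 2 n₁ \ S).val.map
            (fun i => nnsPairValue n₁ n₂ r₁ (G₁.normLapEigenvalue i) (-1))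
        + (Finset.Icc 2 n₁ \ S).val.map
            (fun i => nnsPairValue n₁ n₂ r₁ (G₁.normLapEigenvalue i) 1)
        + Multiset.replicate S.card 1
        + Multiset.replicate S.card (1 + 1 / ((n₁ : ℝ) + n₂ - 1))
        + (nnsCubic n₁ n₂ r₁ r₂).roots := by
  have hV : (1 : ℝ) ≤ n₁ := by rw [← hn₁]; exact_mod_cast Fintype.card_pos
  have hW : (1 : ℝ) ≤ n₂ := by rw [← hn₂]; exact_mod_cast Fintype.card_pos
  obtain ⟨d, hd⟩ : ∃ d : ℝ, d = n₁ + n₂ - 1 := ⟨_, rfl⟩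
  obtain ⟨e, he⟩ : ∃ e : ℝ, e = n₁ + r₂ := ⟨_, rfl⟩
  obtain ⟨c, hc'⟩ : ∃ c : ℝ, c = n₁ - 1 - r₁ := ⟨_, rfl⟩
  have hd0 : 0 < d := by rw [hd]; linarith
  have he0 : 0 < e := by rw [he]; positivity
  have hc0 : 0 < c := by
    have := degree_nnsJoin_inr_inl (G₂ := G₂) h₁ (Classical.arbitrary V)
    rw [hn₁] at this
    rw [hc']
    refine lt_of_le_of_ne ?_ hc.symm
    rw [← this]; positivity
  rw [normLapSpectrum, charpoly_nnsJoin h₁ h₂ hn₁ hn₂ hd hc' he (Z := X - 1) (by simp [hc0.ne']),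
    nnsCubic_eq hc' hd he hd0.ne' he0.ne', ← hd, ← he]
  have hsub : S ⊆ Finset.Icc 2 n₁ := by rw [hS]; exact Finset.filter_subset _ _
  rw [← Finset.prod_sdiff hsub]
  have hP1 : ∏ i ∈ S, ((X - 1) * (X - C (1 - (r₁ - r₁ * G₁.normLapEigenvalue i) / d)) -
      C ((d * c)⁻¹ * (1 + (r₁ - r₁ * G₁.normLapEigenvalue i)) ^ 2)) =
      ∏ i ∈ S, ((X - C 1) * (X - C (1 + 1 / d))) := by
    refine Finset.prod_congr rfl fun i hi => ?_
    rw [hS, Finset.mem_filter, ← one_add_sub_mul_eq_zero_iff] at hi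
    have hl : (r₁ : ℝ) - r₁ * G₁.normLapEigenvalue i = -1 := by linarith [hi.2]
    rw [hl]
    simp [neg_div]
  have hP2 : ∏ i ∈ Finset.Icc 2 n₁ \ S,
      ((X - 1) * (X - C (1 - (r₁ - r₁ * G₁.normLapEigenvalue i) / d)) -
      C ((d * c)⁻¹ * (1 + (r₁ - r₁ * G₁.normLapEigenvalue i)) ^ 2)) =
      ∏ i ∈ Finset.Icc 2 n₁ \ S, ((X - C (nnsPairValue n₁ n₂ r₁ (G₁.normLapEigenvalue i) (-1))) *
        (X - C (nnsPairValue n₁ n₂ r₁ (G₁.normLapEigenvalue i) 1))) := by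
    refine Finset.prod_congr rfl fun i hi => ?_
    rw [hS, Finset.mem_sdiff, Finset.mem_filter, ← one_add_sub_mul_eq_zero_iff] at hi
    exact (X_sub_C_nnsPairValue_mul hc' hd rfl hc0 hd0 fun h => hi.2 ⟨hi.1, h⟩).symm
  rw [hP1, hP2, ← roots_C_mul_prod_mul (inv_ne_zero (mul_pos hd0 he0).ne') _
    (nnsCubic_ne_zero (hd ▸ hd0.ne') (he ▸ he0.ne'))]
  congr 1
  simp only [Multiset.map_add, Multiset.prod_add, Multiset.map_map, Multiset.map_replicate,
    Multiset.prod_replicate, Function.comp_def, Finset.prod_mul_distrib, Finset.prod_const,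
    Finset.prod_map_val]
  ring

theorem normLapSpectrum_nnsJoin_of_eq [Nonempty V] [Nonempty W]
    (h₁ : G₁.IsRegularOfDegree r₁) (h₂ : G₂.IsRegularOfDegree r₂) {n₁ n₂ : ℕ}
    (hn₁ : Fintype.card V = n₁) (hn₂ : Fintype.card W = n₂) (hc : (n₁ : ℝ) - 1 - r₁ = 0) :
    (nnsJoin G₁ G₂).normLapSpectrum =
      (Finset.Icc 2 n₂).val.map
          (fun i => 1 + (r₂ : ℝ) * (G₂.normLapEigenvalue i - 1) / ((n₁ : ℝ) + r₂))
        + Multiset.replicate (n₁ - 1) (1 + 1 / ((n₁ : ℝ) + n₂ - 1))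
        + Multiset.replicate (n₁ + 1) 0
        + {((n₁ : ℝ) ^ 2 + 2 * n₁ * n₂ + r₂ * n₂ - n₁) /
            (((r₂ : ℝ) + n₁) * ((n₁ : ℝ) + n₂ - 1))} := by
  have hV : 1 ≤ n₁ := by rw [← hn₁]; exact Fintype.card_pos
  have hV' : (1 : ℝ) ≤ n₁ := by exact_mod_cast hV
  have hW : (1 : ℝ) ≤ n₂ := by rw [← hn₂]; exact_mod_cast Fintype.card_pos
  have hnr : n₁ = r₁ + 1 := by
    have : (n₁ : ℝ) = r₁ + 1 := by linarith
    exact_mod_cast this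
  have hd0 : (0 : ℝ) < n₁ + n₂ - 1 := by linarith
  have he0 : (0 : ℝ) < n₁ + r₂ := by positivity
  rw [normLapSpectrum, charpoly_nnsJoin h₁ h₂ hn₁ hn₂ rfl rfl rfl (Z := X) (by simp [hc]), hc]
  have hP : ∏ i ∈ Finset.Icc 2 n₁,
      (X * (X - C (1 - (r₁ - r₁ * G₁.normLapEigenvalue i) / ((n₁ : ℝ) + n₂ - 1))) -
      C ((((n₁ : ℝ) + n₂ - 1) * 0)⁻¹ * (1 + (r₁ - r₁ * G₁.normLapEigenvalue i)) ^ 2)) =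
      ∏ i ∈ Finset.Icc 2 n₁, ((X - C 0) * (X - C (1 + 1 / ((n₁ : ℝ) + n₂ - 1)))) := by
    refine Finset.prod_congr rfl fun i hi => ?_
    have hl : (r₁ : ℝ) - r₁ * G₁.normLapEigenvalue i = -1 := by
      linarith [h₁.eigenvalue_of_card_eq (hn₁.trans hnr) (hn₁ ▸ hi)]
    rw [hl]
    simp [neg_div]
  have hR : (X * (X - C (1 - r₁ / ((n₁ : ℝ) + n₂ - 1))) -
        C ((((n₁ : ℝ) + n₂ - 1) * 0)⁻¹ * 0 ^ 2)) * (X - C (1 - r₂ / ((n₁ : ℝ) + r₂))) -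
      C (n₁ * n₂ / (((n₁ : ℝ) + n₂ - 1) * (n₁ + r₂))) * X =
      (X - C 0) ^ 2 * (X - C (((n₁ : ℝ) ^ 2 + 2 * n₁ * n₂ + r₂ * n₂ - n₁) /
            (((r₂ : ℝ) + n₁) * ((n₁ : ℝ) + n₂ - 1)))) := by
    have hr : (r₁ : ℝ) = n₁ - 1 := by linarith
    refine Polynomial.funext fun x => ?_
    simp only [eval_sub, eval_mul, eval_C, eval_X, eval_pow]
    rw [hr, add_comm (r₂ : ℝ)]
    field_simp
    ring
  rw [hP, hR]
  conv_rhs => rw [← roots_multiset_prod_X_sub_C (_ + _)]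
  congr 1
  simp only [Multiset.map_add, Multiset.prod_add, Multiset.map_map, Multiset.map_replicate,
    Multiset.prod_replicate, Function.comp_def, Finset.prod_mul_distrib, Finset.prod_const,
    Finset.prod_map_val, Multiset.map_singleton, Multiset.prod_singleton, Nat.card_Icc]
  have e1 : n₁ + 1 - 2 = n₁ - 1 := by omega
  -- The eigenvalue `0` comes `n₁ - 1` times from the quadratics and twice from the all-ones factor.
  have e2 : n₁ + 1 = (n₁ - 1) + 2 := by omega
  rw [e1, e2, pow_add]
  ring

end SimpleGraph

theorem mainTheorem11 {V₁ V₂ : Type*} [Fintype V₁] [DecidableEq V₁] [Nonempty V₁]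
    [Fintype V₂] [DecidableEq V₂] [Nonempty V₂]
    (G₁ : SimpleGraph V₁) [DecidableRel G₁.Adj] (G₂ : SimpleGraph V₂) [DecidableRel G₂.Adj]
    (n₁ n₂ r₁ r₂ : ℕ) (hn₁ : Fintype.card V₁ = n₁) (hn₂ : Fintype.card V₂ = n₂)
    (hr₁ : G₁.IsRegularOfDegree r₁) (hr₂ : G₂.IsRegularOfDegree r₂)
    (S : Finset ℕ)
    (hS : S = {i ∈ Finset.Icc 2 n₁ | 0 < r₁ ∧ G₁.normLapEigenvalue i = 1 + 1 / (r₁ : ℝ)}) :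
    (2 ≤ n₁ → S = ∅ →
      (SimpleGraph.nnsJoin G₁ G₂).normLapSpectrum =
        (Finset.Icc 2 n₂).val.map
            (fun i => 1 + (r₂ : ℝ) * (G₂.normLapEigenvalue i - 1) / ((n₁ : ℝ) + r₂))
          + (Finset.Icc 2 n₁).val.map
              (fun i => SimpleGraph.nnsPairValue n₁ n₂ r₁ (G₁.normLapEigenvalue i) (-1))
          + (Finset.Icc 2 n₁).val.map
              (fun i => SimpleGraph.nnsPairValue n₁ n₂ r₁ (G₁.normLapEigenvalue i) 1)
          + (SimpleGraph.nnsCubic n₁ n₂ r₁ r₂).roots) ∧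
    (S = Finset.Icc 2 n₁ →
      (SimpleGraph.nnsJoin G₁ G₂).normLapSpectrum =
        (Finset.Icc 2 n₂).val.map
            (fun i => 1 + (r₂ : ℝ) * (G₂.normLapEigenvalue i - 1) / ((n₁ : ℝ) + r₂))
          + Multiset.replicate (n₁ - 1) (1 + 1 / ((n₁ : ℝ) + n₂ - 1))
          + Multiset.replicate (n₁ + 1) 0
          + {((n₁ : ℝ) ^ 2 + 2 * n₁ * n₂ + r₂ * n₂ - n₁) /
              (((r₂ : ℝ) + n₁) * ((n₁ : ℝ) + n₂ - 1))}) ∧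
    (S ≠ ∅ → S ≠ Finset.Icc 2 n₁ →
      (SimpleGraph.nnsJoin G₁ G₂).normLapSpectrum =
        (Finset.Icc 2 n₂).val.map
            (fun i => 1 + (r₂ : ℝ) * (G₂.normLapEigenvalue i - 1) / ((n₁ : ℝ) + r₂))
          + (Finset.Icc 2 n₁ \ S).val.map
              (fun i => SimpleGraph.nnsPairValue n₁ n₂ r₁ (G₁.normLapEigenvalue i) (-1))
          + (Finset.Icc 2 n₁ \ S).val.map
              (fun i => SimpleGraph.nnsPairValue n₁ n₂ r₁ (G₁.normLapEigenvalue i) 1)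
          + Multiset.replicate S.card 1
          + Multiset.replicate S.card (1 + 1 / ((n₁ : ℝ) + n₂ - 1))
          + (SimpleGraph.nnsCubic n₁ n₂ r₁ r₂).roots) := by
  have hV : (1 : ℝ) ≤ n₁ := by rw [← hn₁]; exact_mod_cast Fintype.card_pos
  have hne : S ≠ Finset.Icc 2 n₁ → (n₁ : ℝ) - 1 - r₁ ≠ 0 := by
    intro h hc
    have hnr : n₁ = r₁ + 1 := by
      have : (n₁ : ℝ) = r₁ + 1 := by linarith
      exact_mod_cast this
    refine h (hS.trans (Finset.filter_true_of_mem fun i hi => ?_))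
    exact (SimpleGraph.one_add_sub_mul_eq_zero_iff _ _).1
      (hr₁.eigenvalue_of_card_eq (hn₁.trans hnr) (hn₁ ▸ hi))
  refine ⟨fun h2 hE => ?_, fun hE => ?_, fun _ hE => ?_⟩
  · have hc := hne (by rw [hE]; exact (Finset.nonempty_Icc.2 h2).ne_empty.symm)
    have := SimpleGraph.normLapSpectrum_nnsJoin_of_ne hr₁ hr₂ hn₁ hn₂ hc hS
    rw [this, hE]
    simp
  · refine SimpleGraph.normLapSpectrum_nnsJoin_of_eq hr₁ hr₂ hn₁ hn₂ ?_
    -- If every `r₁ δᵢ` with `i ≥ 2` equals `1 + r₁`, the trace gives `(n₁ - 1)(1 + r₁) = r₁ n₁`,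
    -- that is `n₁ = r₁ + 1`; this includes `n₁ = 1`.
    have hsum := hr₁.sum_normLapEigenvalue
    have hi : ∀ i ∈ Finset.Icc 2 n₁, (r₁ : ℝ) * G₁.normLapEigenvalue i = 1 + r₁ := by
      intro i hi
      rw [← hE, hS, Finset.mem_filter, ← SimpleGraph.one_add_sub_mul_eq_zero_iff] at hi
      linarith [hi.2]
    rw [hn₁, Finset.sum_congr rfl hi, Finset.sum_const, Nat.card_Icc, nsmul_eq_mul,
      Nat.cast_sub (by have : 1 ≤ n₁ := by exact_mod_cast hV
                       omega)] at hsum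
    push_cast at hsum
    linarith
  · exact SimpleGraph.normLapSpectrum_nnsJoin_of_ne hr₁ hr₂ hn₁ hn₂ (hne hE) hS
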